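/- Let $M>0$, let $v:\mathbb{Z}\to[-M,M]$, and let $H_v$ be the bounded operator on the complex Hilbert space $\ell^2(\mathbb{Z})$ given by $(H_vu)_n=u_{n+1}+u_{n-1}+v(n)u_n$, with spectrum $\sigma(H_v)=\{E\in\mathbb{C}: H_v-E \text{ is not invertible}\}$. For $E\in\mathbb{R}$ let $A^{(E-v)}:\mathbb{Z}\to\mathrm{SL}(2,\mathbb{R})$ be the Schrödinger cocycle map $A^{(E-v)}(n)=\begin{pmatrix}E-v(n)&-1\\1&0\end{pmatrix}$. For a bounded map $A:\mathbb{Z}\to\mathrm{SL}(2,\mathbb{R})$ put $A_n(k)=A(k+n-1)\cdots A(k)$ for $n\ge1$, $A_0(k)=I$, and $A_n(k)=A(k+n)^{-1}\cdots A(k-1)^{-1}$ for $n\le-1$. Call $A$ uniformly hyperbolic if there are maps $u,s:\mathbb{Z}\to\mathbb{R}\mathbb{P}^1$ such that $A(k)\cdot u(k)=u(k+1)$ and $A(k)\cdot s(k)=s(k+1)$ for all $k\in\mathbb{Z}$, and constants $C>0$, $\lambda>1$ such that $\|A_{-n}(k)x\|\le C\lambda^{-n}$ and $\|A_n(k)y\|\le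 C\lambda^{-n}$ for all $n\ge1$, $k\in\mathbb{Z}$ and all unit vectors $x\in u(k)$, $y\in s(k)$ (Euclidean norm on $\mathbb{R}^2$). Then $$\sigma(H_v)=\{E\in\mathbb{R}: A^{(E-v)}\text{ is not uniformly hyperbolic}\}.$$ In particular $\sigma(H_v)\subset\mathbb{R}$. -/

import Mathlib

namespace DiscreteSchrodinger

open scoped Matrix MatrixGroups LinearAlgebra.Projectivization

/-! ### Uniformly hyperbolic sequences of `SL(2, ℝ)` matrices -/

/-- The forward products `A(k+n-1) ⋯ A(k)`. -/
def forwardProd (A : ℤ → SL(2, ℝ)) (k : ℤ) : ℕ → SL(2, ℝ)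
  | 0 => 1
  | n + 1 => A (k + n) * forwardProd A k n

/-- The backward products `A(k-n)⁻¹ ⋯ A(k-1)⁻¹`. -/
def backwardProd (A : ℤ → SL(2, ℝ)) (k : ℤ) : ℕ → SL(2, ℝ)
  | 0 => 1
  | n + 1 => (A (k - (n + 1)))⁻¹ * backwardProd A k n

/-- The iterates `A_n(k)`, for `n : ℤ`: `A(k+n-1) ⋯ A(k)` for `n ≥ 1`, the identity for `n = 0`,
and `A(k+n)⁻¹ ⋯ A(k-1)⁻¹` for `n ≤ -1`. -/
def iter (A : ℤ → SL(2, ℝ)) : ℤ → ℤ → SL(2, ℝ)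
  | Int.ofNat n, k => forwardProd A k n
  | Int.negSucc n, k => backwardProd A k (n + 1)

/-- The Euclidean norm on `ℝ²`. -/
noncomputable def euclNorm (x : Fin 2 → ℝ) : ℝ := ‖WithLp.toLp 2 x‖

/-- Uniform hyperbolicity of a sequence `A : ℤ → SL(2, ℝ)`. The directions `u`, `s` are maps from
`ℤ` to the real projective line, on which `SL(2, ℝ)` acts by Mathlib's projective action. -/
def IsUniformlyHyperbolic (A : ℤ → SL(2, ℝ)) : Prop :=
  ∃ u s : ℤ → ℙ ℝ (Fin 2 → ℝ),
    (∀ k : ℤ, A k • u k = u (k + 1) ∧ A k • s k = s (k + 1)) ∧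
    ∃ C lam : ℝ, 0 < C ∧ 1 < lam ∧
      ∀ n : ℕ, 1 ≤ n → ∀ k : ℤ,
        (∀ x ∈ (u k).submodule, euclNorm x = 1 →
          euclNorm ((iter A (-(n : ℤ)) k).1 *ᵥ x) ≤ C * lam ^ (-(n : ℤ))) ∧
        (∀ x ∈ (s k).submodule, euclNorm x = 1 →
          euclNorm ((iter A (n : ℤ) k).1 *ᵥ x) ≤ C * lam ^ (-(n : ℤ)))

/-! ### The Schrödinger cocycle -/

/-- The matrix `A^{(x)} = (x, -1; 1, 0)`. -/
def transferMatrix (x : ℝ) : SL(2, ℝ) :=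
  ⟨!![x, -1; 1, 0], by simp [Matrix.det_fin_two]⟩

/-- The Schrödinger cocycle map `A^{(E - v)}(n) = A^{(E - v(n))}`. -/
def cocycle (E : ℝ) (v : ℤ → ℝ) : ℤ → SL(2, ℝ) := fun n => transferMatrix (E - v n)

/-! ### The Schrödinger operator on `ℓ²(ℤ)` -/

/-- The complex Hilbert space `ℓ²(ℤ)`. -/
abbrev ell2 : Type := lp (fun _ : ℤ => ℂ) 2

theorem memℓp_translate (u : ell2) (m : ℤ) : Memℓp (fun n : ℤ => u (n + m)) 2 := by
  have h2 : (0 : ℝ) < (2 : ENNReal).toReal := by norm_num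
  exact memℓp_gen (((lp.memℓp u).summable h2).comp_injective (add_left_injective m))

theorem norm_translate (u : ell2) (m : ℤ) :
    ‖(⟨fun n : ℤ => u (n + m), memℓp_translate u m⟩ : ell2)‖ = ‖u‖ := by
  have h2 : (0 : ℝ) < (2 : ENNReal).toReal := by norm_num
  rw [lp.norm_eq_tsum_rpow h2, lp.norm_eq_tsum_rpow h2]
  congr 1
  exact (Equiv.addRight m).tsum_eq (fun n : ℤ => ‖u n‖ ^ (2 : ENNReal).toReal)

theorem norm_potential_mul_le {v : ℤ → ℝ} {M : ℝ} (hv : ∀ n, |v n| ≤ M) (u : ell2) (n : ℤ) :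
    ‖(v n : ℂ) * u n‖ ≤ ‖((M : ℂ) • u) n‖ := by
  have hM : |v n| ≤ |M| := (hv n).trans (le_abs_self M)
  rw [lp.coeFn_smul, Pi.smul_apply, smul_eq_mul, norm_mul, norm_mul, Complex.norm_real,
    Complex.norm_real]
  exact mul_le_mul_of_nonneg_right hM (norm_nonneg _)

theorem memℓp_potential_mul {v : ℤ → ℝ} {M : ℝ} (hv : ∀ n, |v n| ≤ M) (u : ell2) :
    Memℓp (fun n : ℤ => (v n : ℂ) * u n) 2 := by
  have h : Memℓp (fun n : ℤ => ((M : ℂ) • u) n) 2 := lp.memℓp ((M : ℂ) • u)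
  exact Memℓp.mono' (f := fun n : ℤ => (v n : ℂ) * u n) h (norm_potential_mul_le hv u)

theorem memℓp_schrodinger {v : ℤ → ℝ} {M : ℝ} (hv : ∀ n, |v n| ≤ M) (u : ell2) :
    Memℓp (fun n : ℤ => u (n + 1) + u (n - 1) + (v n : ℂ) * u n) 2 :=
  ((memℓp_translate u 1).add (memℓp_translate u (-1))).add (memℓp_potential_mul hv u)

theorem norm_schrodinger_le {v : ℤ → ℝ} {M : ℝ} (hv : ∀ n, |v n| ≤ M) (u : ell2) :
    ‖(⟨fun n : ℤ => u (n + 1) + u (n - 1) + (v n : ℂ) * u n, memℓp_schrodinger hv u⟩ : ell2)‖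
      ≤ (2 + M) * ‖u‖ := by
  have hM : 0 ≤ M := (abs_nonneg _).trans (hv 0)
  have h3 : ‖(⟨fun n : ℤ => (v n : ℂ) * u n, memℓp_potential_mul hv u⟩ : ell2)‖ ≤ M * ‖u‖ := by
    have h := lp.norm_mono (p := 2) (by norm_num)
      (x := (⟨fun n : ℤ => (v n : ℂ) * u n, memℓp_potential_mul hv u⟩ : ell2))
      (y := (M : ℂ) • u) (norm_potential_mul_le hv u)
    rwa [norm_smul, Complex.norm_real, Real.norm_of_nonneg hM] at h
  have h := norm_add₃_le
    (a := (⟨fun n : ℤ => u (n + 1), memℓp_translate u 1⟩ : ell2))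
    (b := (⟨fun n : ℤ => u (n + -1), memℓp_translate u (-1)⟩ : ell2))
    (c := (⟨fun n : ℤ => (v n : ℂ) * u n, memℓp_potential_mul hv u⟩ : ell2))
  rw [norm_translate, norm_translate] at h
  refine le_trans (le_of_eq ?_) (h.trans (by linarith))
  rfl

/-- The discrete Schrödinger operator `(H_v u)_n = u_{n+1} + u_{n-1} + v(n) u_n` on `ℓ²(ℤ)`, as a
bounded operator, for a real potential `v` bounded by `M`. -/
noncomputable def schrodinger (v : ℤ → ℝ) {M : ℝ} (hv : ∀ n, |v n| ≤ M) : ell2 →L[ℂ] ell2 :=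
  LinearMap.mkContinuous
    { toFun := fun u =>
        ⟨fun n : ℤ => u (n + 1) + u (n - 1) + (v n : ℂ) * u n, memℓp_schrodinger hv u⟩
      map_add' := fun u w => by
        ext n
        simp only [lp.coeFn_add, Pi.add_apply]
        ring
      map_smul' := fun c u => by
        ext n
        simp only [lp.coeFn_smul, Pi.smul_apply, smul_eq_mul, RingHom.id_apply]
        ring }
    (2 + M) (norm_schrodinger_le hv)

theorem schrodinger_apply (v : ℤ → ℝ) {M : ℝ} (hv : ∀ n, |v n| ≤ M) (u : ell2) (n : ℤ) :
    schrodinger v hv u n = u (n + 1) + u (n - 1) + (v n : ℂ) * u n := rfl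

end DiscreteSchrodinger

/-!
The operator `H_v` is self-adjoint, so its spectrum is real and a real `E` lies outside it exactly
when `H_v - E` is bounded below (`notMem_spectrum_iff_bounded_below`). It remains to see that this
lower bound is equivalent to uniform hyperbolicity of the cocycle `A = A^{(E - v)}`. Both directions
use the vectors `W k = (w k, w (k - 1))`: a sequence `w` solves `H_v w = E w` exactly when `W` is an
orbit of `A`, and `(H_v - E) w = f` says that `W` is an orbit up to the defect `(f k, 0)`.

If `A` is uniformly hyperbolic, write a vector as a sum of its components along `u` and `s`. One
grows forwards and the other backwards, so for a suitable `n`, uniformly in `k` and `X`,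
`8 ‖X‖² ≤ ‖A_n(k) X‖² + ‖A_{-n}(k) X‖²` (`IsUniformlyHyperbolic.exists_growth`). For `X = W k` the
right-hand side differs from `W (k ± n)` by finitely many defects. Summing over `k` and using that
translations preserve the `ℓ²` norm gives `8 ‖W‖² ≤ 4 ‖W‖² + C ‖f‖²`, a lower bound for `H_v - E`
(`bounded_below_of_isUniformlyHyperbolic`).

If `H_v - E` is bounded below, apply it to a solution truncated to an interval: the image is
supported at the ends, so the sum of `‖W k‖²` over any block is at most a constant times its two
boundary values (`exists_orbit_block_sum_le`). Hence an orbit with summable `‖W k‖²` on a half line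
decays geometrically there, from every starting point and with uniform constants
(`decay_of_block_sum_le`). Such an orbit exists: a matrix of determinant one leaves some unit vector
unexpanded, which bounds the block sum up to any given time, and compactness of the circle yields
one vector good for all times (`exists_bounded_orbit_sum`). Doing this in both time directions gives
orbits whose lines serve as `s` and `u` (`isUniformlyHyperbolic_of_decay`).
-/

namespace DiscreteSchrodinger

open scoped Matrix MatrixGroups LinearAlgebra.Projectivization

/-! ### Self-adjointness and the spectrum -/

/-- For a self-adjoint operator, being bounded below already gives dense range, because the
orthogonal complement of the range is the kernel. -/
theorem isUnit_iff_bounded_below {F : Type*} [NormedAddCommGroup F] [InnerProductSpace ℂ F]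
    [CompleteSpace F] {T : F →L[ℂ] F} (hT : IsSelfAdjoint T) :
    IsUnit T ↔ ∃ c : ℝ, 0 < c ∧ ∀ x, c * ‖x‖ ≤ ‖T x‖ := by
  constructor
  · rintro ⟨U, rfl⟩
    refine ⟨(‖(↑U⁻¹ : F →L[ℂ] F)‖ + 1)⁻¹, by positivity, fun x => ?_⟩
    have h : (↑U⁻¹ : F →L[ℂ] F) ((U : F →L[ℂ] F) x) = x := by
      rw [← mul_apply_eq_comp, Units.inv_mul, one_apply_eq_self]
    have h2 := (↑U⁻¹ : F →L[ℂ] F).le_opNorm ((U : F →L[ℂ] F) x)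
    rw [h] at h2
    rw [inv_mul_le_iff₀ (by positivity)]
    nlinarith [norm_nonneg ((U : F →L[ℂ] F) x)]
  · rintro ⟨c, hc, h⟩
    rw [ContinuousLinearMap.isUnit_iff_bijective,
      ContinuousLinearMap.bijective_iff_dense_range_and_antilipschitz]
    constructor
    · rw [Submodule.topologicalClosure_eq_top_iff, Submodule.eq_bot_iff]
      intro x hx
      have hx0 : T x = 0 := by
        rw [T.orthogonal_range, ← ContinuousLinearMap.star_eq_adjoint, hT.star_eq] at hx
        exact hx
      have h2 := h x
      rw [hx0, norm_zero] at h2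
      exact norm_le_zero_iff.mp (nonpos_of_mul_nonpos_right h2 hc)
    · refine ⟨(Real.toNNReal c)⁻¹, T.antilipschitz_of_bound fun x => ?_⟩
      rw [NNReal.coe_inv, Real.coe_toNNReal c hc.le, inv_mul_eq_div, le_div_iff₀ hc, mul_comm]
      exact h x

/-- Translation `u ↦ u(· + m)` on `ℓ²(ℤ)`, as a map of vectors. -/
noncomputable def translate (u : ell2) (m : ℤ) : ell2 :=
  ⟨fun n : ℤ => u (n + m), memℓp_translate u m⟩

/-- Multiplication by a bounded real potential on `ℓ²(ℤ)`, as a map of vectors. -/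
noncomputable def potentialMul {v : ℤ → ℝ} {M : ℝ} (hv : ∀ n, |v n| ≤ M) (u : ell2) : ell2 :=
  ⟨fun n : ℤ => (v n : ℂ) * u n, memℓp_potential_mul hv u⟩

theorem inner_translate (u w : ell2) (m : ℤ) :
    inner ℂ (translate u m) w = inner ℂ u (translate w (-m)) := by
  rw [lp.inner_eq_tsum, lp.inner_eq_tsum, ← (Equiv.addRight (-m)).tsum_eq]
  refine tsum_congr fun n => ?_
  change inner ℂ (u (n + -m + m)) (w (n + -m)) = inner ℂ (u n) (w (n + -m))
  rw [neg_add_cancel_right]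

theorem inner_potentialMul {v : ℤ → ℝ} {M : ℝ} (hv : ∀ n, |v n| ≤ M) (u w : ell2) :
    inner ℂ (potentialMul hv u) w = inner ℂ u (potentialMul hv w) := by
  rw [lp.inner_eq_tsum, lp.inner_eq_tsum]
  refine tsum_congr fun n => ?_
  change inner ℂ ((v n : ℂ) * u n) (w n) = inner ℂ (u n) ((v n : ℂ) * w n)
  simp only [RCLike.inner_apply, map_mul, Complex.conj_ofReal]
  ring

theorem schrodinger_eq_sum {v : ℤ → ℝ} {M : ℝ} (hv : ∀ n, |v n| ≤ M) (u : ell2) :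
    schrodinger v hv u = translate u 1 + translate u (-1) + potentialMul hv u := rfl

theorem isSelfAdjoint_schrodinger {v : ℤ → ℝ} {M : ℝ} (hv : ∀ n, |v n| ≤ M) :
    IsSelfAdjoint (schrodinger v hv) := by
  rw [ContinuousLinearMap.isSelfAdjoint_iff_isSymmetric]
  intro u w
  change inner ℂ (schrodinger v hv u) w = inner ℂ u (schrodinger v hv w)
  rw [schrodinger_eq_sum, schrodinger_eq_sum]
  simp only [inner_add_left, inner_add_right, inner_translate, inner_potentialMul, neg_neg]
  ring

/-- Weyl's criterion, without approximate eigenvectors: no sequence of unit vectors `u` has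
`(H_v - E) u → 0` exactly when `E` is in the resolvent set. -/
theorem notMem_spectrum_iff_bounded_below {v : ℤ → ℝ} {M : ℝ} (hv : ∀ n, |v n| ≤ M) (E : ℝ) :
    (E : ℂ) ∉ spectrum ℂ (schrodinger v hv) ↔
      ∃ c : ℝ, 0 < c ∧ ∀ u : ell2, c * ‖u‖ ≤ ‖schrodinger v hv u - (E : ℂ) • u‖ := by
  have hsa : IsSelfAdjoint (schrodinger v hv - algebraMap ℂ (ell2 →L[ℂ] ell2) E) := by
    refine (isSelfAdjoint_schrodinger hv).sub ?_
    rw [IsSelfAdjoint, ← algebraMap_star_comm]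
    simp
  rw [spectrum.notMem_iff, ← IsUnit.neg_iff, neg_sub, isUnit_iff_bounded_below hsa]
  rfl

theorem spectrum_schrodinger_eq_re {v : ℤ → ℝ} {M : ℝ} (hv : ∀ n, |v n| ≤ M) {z : ℂ}
    (hz : z ∈ spectrum ℂ (schrodinger v hv)) : z = z.re :=
  (isSelfAdjoint_schrodinger hv).mem_spectrum_eq_re hz

/-! ### Orbits of the cocycle -/

section Orbit

variable {α : Type*} [MulAction SL(2, ℝ) α] {A : ℤ → SL(2, ℝ)} {x : ℤ → α}

theorem forwardProd_smul (hx : ∀ k, A k • x k = x (k + 1)) (k : ℤ) (n : ℕ) :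
    forwardProd A k n • x k = x (k + n) := by
  induction n with
  | zero => simp [forwardProd]
  | succ n ih => rw [forwardProd, mul_smul, ih, hx, Nat.cast_succ, add_assoc]

theorem backwardProd_smul (hx : ∀ k, A k • x k = x (k + 1)) (k : ℤ) (n : ℕ) :
    backwardProd A k n • x k = x (k - n) := by
  induction n with
  | zero => simp [backwardProd]
  | succ n ih =>
    rw [backwardProd, mul_smul, ih, inv_smul_eq_iff, Nat.cast_succ, hx]
    congr 1
    ring

theorem iter_natCast (A : ℤ → SL(2, ℝ)) (k : ℤ) (n : ℕ) :
    iter A (n : ℤ) k = forwardProd A k n := rfl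

theorem iter_neg_natCast (A : ℤ → SL(2, ℝ)) (k : ℤ) (n : ℕ) :
    iter A (-(n : ℤ)) k = backwardProd A k n := by
  cases n <;> rfl

theorem iter_succ (A : ℤ → SL(2, ℝ)) (n k : ℤ) :
    iter A (n + 1) k = A (k + n) * iter A n k := by
  obtain ⟨m, rfl | rfl⟩ := n.eq_nat_or_neg
  · rfl
  · cases m with
    | zero => rfl
    | succ m =>
      have h : -((m + 1 : ℕ) : ℤ) + 1 = -(m : ℤ) := by push_cast; ring
      rw [h, iter_neg_natCast, iter_neg_natCast, backwardProd, ← mul_assoc]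
      have h2 : k + -((m + 1 : ℕ) : ℤ) = k - (m + 1) := by push_cast; ring
      rw [h2, mul_inv_cancel, one_mul]

theorem iter_smul_orbit (A : ℤ → SL(2, ℝ)) (X : α) (k : ℤ) :
    A k • iter A k 0 • X = iter A (k + 1) 0 • X := by
  rw [iter_succ, mul_smul, zero_add]

theorem exists_orbit (A : ℤ → SL(2, ℝ)) (k : ℤ) (X : α) :
    ∃ x : ℤ → α, x k = X ∧ ∀ j, A j • x j = x (j + 1) := by
  refine ⟨fun j => iter A j 0 • (iter A k 0)⁻¹ • X, smul_inv_smul _ _, fun j =>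
    iter_smul_orbit A _ j⟩

theorem backwardProd_smul_forwardProd_smul (A : ℤ → SL(2, ℝ)) (k : ℤ) (n : ℕ) (X : α) :
    backwardProd A (k + n) n • forwardProd A k n • X = X := by
  obtain ⟨x, rfl, hx⟩ := exists_orbit A k X
  rw [forwardProd_smul hx, backwardProd_smul hx, add_sub_cancel_right]

theorem forwardProd_smul_backwardProd_smul (A : ℤ → SL(2, ℝ)) (k : ℤ) (n : ℕ) (X : α) :
    forwardProd A (k - n) n • backwardProd A k n • X = X := by
  obtain ⟨x, rfl, hx⟩ := exists_orbit A k X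
  rw [backwardProd_smul hx, forwardProd_smul hx, sub_add_cancel]

end Orbit

/-! ### The Euclidean norm on the plane -/

/-- The square of the Euclidean norm on `ℝ²`. -/
def normSq (X : Fin 2 → ℝ) : ℝ := X 0 ^ 2 + X 1 ^ 2

theorem normSq_nonneg (X : Fin 2 → ℝ) : 0 ≤ normSq X := by unfold normSq; positivity

theorem normSq_add_le (X Y : Fin 2 → ℝ) : normSq (X + Y) ≤ 2 * normSq X + 2 * normSq Y := by
  simp only [normSq, Pi.add_apply]
  nlinarith [sq_nonneg (X 0 - Y 0), sq_nonneg (X 1 - Y 1)]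

theorem normSq_sub_le (X Y : Fin 2 → ℝ) : normSq (X - Y) ≤ 2 * normSq X + 2 * normSq Y := by
  simp only [normSq, Pi.sub_apply]
  nlinarith [sq_nonneg (X 0 + Y 0), sq_nonneg (X 1 + Y 1)]

theorem normSq_smul (c : ℝ) (X : Fin 2 → ℝ) : normSq (c • X) = c ^ 2 * normSq X := by
  simp only [normSq, Pi.smul_apply, smul_eq_mul]
  ring

theorem normSq_pos {X : Fin 2 → ℝ} (hX : X ≠ 0) : 0 < normSq X := by
  refine lt_of_le_of_ne (normSq_nonneg X) fun h => hX ?_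
  unfold normSq at h
  have h0 : X 0 = 0 := by nlinarith [sq_nonneg (X 0), sq_nonneg (X 1)]
  have h1 : X 1 = 0 := by nlinarith [sq_nonneg (X 0), sq_nonneg (X 1)]
  ext i
  fin_cases i <;> assumption

theorem euclNorm_nonneg (X : Fin 2 → ℝ) : 0 ≤ euclNorm X := norm_nonneg _

theorem euclNorm_sq (X : Fin 2 → ℝ) : euclNorm X ^ 2 = normSq X := by
  rw [euclNorm, EuclideanSpace.norm_sq_eq]
  simp [normSq, Fin.sum_univ_two]

theorem euclNorm_smul (c : ℝ) (X : Fin 2 → ℝ) : euclNorm (c • X) = |c| * euclNorm X := by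
  rw [euclNorm, WithLp.toLp_smul, norm_smul, Real.norm_eq_abs, euclNorm]

theorem euclNorm_add_le (X Y : Fin 2 → ℝ) : euclNorm (X + Y) ≤ euclNorm X + euclNorm Y := by
  rw [euclNorm, WithLp.toLp_add]
  exact norm_add_le _ _

theorem euclNorm_eq_zero {X : Fin 2 → ℝ} : euclNorm X = 0 ↔ X = 0 := by
  rw [euclNorm, norm_eq_zero, WithLp.toLp_eq_zero]

theorem specialLinearGroup_smul_eq_mulVec (g : SL(2, ℝ)) (X : Fin 2 → ℝ) : g • X = g.1 *ᵥ X := rfl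

/-! ### Hyperbolicity forces growth in one of the two time directions -/

theorem smul_mem_submodule (g : SL(2, ℝ)) (p : ℙ ℝ (Fin 2 → ℝ)) {X : Fin 2 → ℝ}
    (hX : X ∈ p.submodule) : g • X ∈ (g • p).submodule := by
  induction p with
  | h w hw =>
    rw [Projectivization.smul_mk]
    rw [Projectivization.submodule_mk, Submodule.mem_span_singleton] at hX ⊢
    obtain ⟨c, rfl⟩ := hX
    exact ⟨c, (smul_comm _ _ _).symm⟩

theorem euclNorm_smul_le_of_unit {p : ℙ ℝ (Fin 2 → ℝ)} {g : SL(2, ℝ)} {ε : ℝ}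
    (h : ∀ x ∈ p.submodule, euclNorm x = 1 → euclNorm (g.1 *ᵥ x) ≤ ε)
    {X : Fin 2 → ℝ} (hX : X ∈ p.submodule) : euclNorm (g • X) ≤ ε * euclNorm X := by
  by_cases h0 : X = 0
  · simp [h0, euclNorm_eq_zero.mpr rfl]
  have hpos : 0 < euclNorm X :=
    lt_of_le_of_ne (euclNorm_nonneg X) fun h => h0 (euclNorm_eq_zero.mp h.symm)
  have h1 := h ((euclNorm X)⁻¹ • X) (Submodule.smul_mem _ _ hX) (by
    rw [euclNorm_smul, abs_of_pos (by positivity), inv_mul_cancel₀ hpos.ne'])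
  rw [Matrix.mulVec_smul, euclNorm_smul, abs_of_pos (by positivity), inv_mul_le_iff₀ hpos,
    mul_comm] at h1
  exact h1

/-- Two distinct lines span the plane. -/
theorem exists_add_of_ne {p q : ℙ ℝ (Fin 2 → ℝ)} (hpq : p ≠ q) (X : Fin 2 → ℝ) :
    ∃ x ∈ p.submodule, ∃ y ∈ q.submodule, X = x + y := by
  induction p with
  | h a ha =>
  induction q with
  | h b hb =>
    simp only [Projectivization.submodule_mk]
    have hd : a 0 * b 1 - a 1 * b 0 ≠ 0 := by
      intro hd
      apply hpq
      rw [Projectivization.mk_eq_mk_iff']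
      by_cases h0 : b 0 = 0
      · have h1 : b 1 ≠ 0 := fun h1 => hb (by ext i; fin_cases i <;> assumption)
        refine ⟨a 1 / b 1, ?_⟩
        have ha0 : a 0 = 0 := by simpa [h0, h1] using hd
        ext i
        fin_cases i
        · simp [h0, ha0]
        · simp [h1]
      · refine ⟨a 0 / b 0, ?_⟩
        ext i
        fin_cases i
        · simp [h0]
        · simp only [Fin.mk_one, Pi.smul_apply, smul_eq_mul]
          field_simp
          linarith
    refine ⟨_, Submodule.smul_mem _ ((X 0 * b 1 - X 1 * b 0) / (a 0 * b 1 - a 1 * b 0))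
      (Submodule.mem_span_singleton_self a), _,
      Submodule.smul_mem _ ((a 0 * X 1 - a 1 * X 0) / (a 0 * b 1 - a 1 * b 0))
      (Submodule.mem_span_singleton_self b), ?_⟩
    ext i
    fin_cases i
    · simp only [Fin.zero_eta, Pi.add_apply, Pi.smul_apply, smul_eq_mul]
      rw [div_mul_eq_mul_div, div_mul_eq_mul_div, ← add_div, eq_div_iff hd]
      ring
    · simp only [Fin.mk_one, Pi.add_apply, Pi.smul_apply, smul_eq_mul]
      rw [div_mul_eq_mul_div, div_mul_eq_mul_div, ← add_div, eq_div_iff hd]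
      ring

/-- In a uniformly hyperbolic system some fixed number of steps, forwards or backwards, enlarges
every vector: the component along `u` grows forwards and the component along `s` backwards. -/
theorem IsUniformlyHyperbolic.exists_growth {A : ℤ → SL(2, ℝ)} (h : IsUniformlyHyperbolic A) :
    ∃ n : ℕ, ∀ (k : ℤ) (X : Fin 2 → ℝ),
      8 * normSq X ≤ normSq (forwardProd A k n • X) + normSq (backwardProd A k n • X) := by
  obtain ⟨u, s, hus, C, lam, hC, hlam, hdec⟩ := h
  have hu := fun k => (hus k).1
  have hs := fun k => (hus k).2
  obtain ⟨n, hn1, hn⟩ : ∃ n : ℕ, 1 ≤ n ∧ C * lam ^ (-(n : ℤ)) ≤ 1 / 5 := by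
    obtain ⟨n, hn⟩ := pow_unbounded_of_one_lt (5 * C) hlam
    refine ⟨n + 1, by omega, ?_⟩
    have h1 : 5 * C < lam ^ (n + 1) := hn.trans (pow_lt_pow_right₀ hlam (by omega))
    rw [zpow_neg, zpow_natCast, ← div_eq_mul_inv, div_le_iff₀ (by positivity)]
    linarith
  obtain ⟨ε, hε⟩ : ∃ ε, ε = C * lam ^ (-(n : ℤ)) := ⟨_, rfl⟩
  have hε0 : 0 < ε := by rw [hε]; positivity
  rw [← hε] at hn
  have hU : ∀ k, ∀ x ∈ (u k).submodule, euclNorm (backwardProd A k n • x) ≤ ε * euclNorm x := by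
    intro k x hx
    refine euclNorm_smul_le_of_unit (fun y hy hy1 => ?_) hx
    rw [hε, ← iter_neg_natCast]
    exact (hdec n hn1 k).1 y hy hy1
  have hS : ∀ k, ∀ x ∈ (s k).submodule, euclNorm (forwardProd A k n • x) ≤ ε * euclNorm x := by
    intro k x hx
    refine euclNorm_smul_le_of_unit (fun y hy hy1 => ?_) hx
    rw [hε, ← iter_natCast]
    exact (hdec n hn1 k).2 y hy hy1
  have hU' : ∀ k, ∀ x ∈ (u k).submodule, euclNorm x ≤ ε * euclNorm (forwardProd A k n • x) := by
    intro k x hx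
    have h1 := smul_mem_submodule (forwardProd A k n) _ hx
    rw [forwardProd_smul hu] at h1
    have h2 := hU _ _ h1
    rwa [backwardProd_smul_forwardProd_smul] at h2
  have hS' : ∀ k, ∀ x ∈ (s k).submodule, euclNorm x ≤ ε * euclNorm (backwardProd A k n • x) := by
    intro k x hx
    have h1 := smul_mem_submodule (backwardProd A k n) _ hx
    rw [backwardProd_smul hs] at h1
    have h2 := hS _ _ h1
    rwa [forwardProd_smul_backwardProd_smul] at h2
  refine ⟨n, fun k X => ?_⟩
  have hne : u k ≠ s k := by
    intro heq
    have hm : (u k).rep ∈ (u k).submodule := by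
      rw [Projectivization.submodule_eq]
      exact Submodule.mem_span_singleton_self _
    have h1 := hU' k _ hm
    have h2 := hS k (u k).rep (by rw [← heq]; exact hm)
    have h3 : 0 < euclNorm (u k).rep :=
      lt_of_le_of_ne (euclNorm_nonneg _) fun h => (u k).rep_nonzero (euclNorm_eq_zero.mp h.symm)
    nlinarith [euclNorm_nonneg (forwardProd A k n • (u k).rep)]
  obtain ⟨x, hx, y, hy, rfl⟩ := exists_add_of_ne hne X
  have triangle : ∀ g : SL(2, ℝ), ∀ a b : Fin 2 → ℝ,
      euclNorm (g • a) ≤ euclNorm (g • (a + b)) + euclNorm (g • b) := by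
    intro g a b
    have h1 := euclNorm_add_le (g • (a + b)) ((-1 : ℝ) • (g • b))
    rw [euclNorm_smul, abs_neg, abs_one, one_mul, smul_add, neg_smul, one_smul,
      add_neg_cancel_right, ← smul_add] at h1
    exact h1
  have t1 := triangle (forwardProd A k n) x y
  have t2 := triangle (backwardProd A k n) y x
  rw [add_comm y x] at t2
  have hF : 5 * euclNorm x ≤ euclNorm (forwardProd A k n • x) := by
    nlinarith [hU' k x hx, euclNorm_nonneg (forwardProd A k n • x)]
  have hB : 5 * euclNorm y ≤ euclNorm (backwardProd A k n • y) := by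
    nlinarith [hS' k y hy, euclNorm_nonneg (backwardProd A k n • y)]
  have hF2 : euclNorm (forwardProd A k n • y) ≤ euclNorm y := by
    nlinarith [hS k y hy, euclNorm_nonneg y]
  have hB2 : euclNorm (backwardProd A k n • x) ≤ euclNorm x := by
    nlinarith [hU k x hx, euclNorm_nonneg x]
  have hsum : 4 * euclNorm (x + y) ≤ euclNorm (forwardProd A k n • (x + y)) +
      euclNorm (backwardProd A k n • (x + y)) := by
    linarith [euclNorm_add_le x y]
  simp only [← euclNorm_sq]
  have h0 := euclNorm_nonneg (x + y)
  nlinarith [sq_nonneg (euclNorm (forwardProd A k n • (x + y)) -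
    euclNorm (backwardProd A k n • (x + y)))]

/-! ### Square-summable approximate solutions -/

theorem summable_and_tsum_le_of_le_add {a b d : ℤ → ℝ} {p q : ℝ} (m : ℤ) (ha : ∀ k, 0 ≤ a k)
    (hb : Summable b) (hd : Summable d) (h : ∀ k, a k ≤ p * b k + q * d (k + m)) :
    Summable a ∧ ∑' k, a k ≤ p * ∑' k, b k + q * ∑' k, d k := by
  have hd' : Summable fun k => d (k + m) := hd.comp_injective (add_left_injective m)
  have hs := (hb.mul_left p).add (hd'.mul_left q)
  have hsum : Summable a := Summable.of_nonneg_of_le ha h hs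
  refine ⟨hsum, (hsum.tsum_le_tsum h hs).trans_eq ?_⟩
  rw [(hb.mul_left p).tsum_add (hd'.mul_left q), tsum_mul_left, tsum_mul_left,
    ← (Equiv.addRight m).tsum_eq d]
  rfl

/-- A sequence `W` with defect `G` shadows the exact orbits over `n` forward steps, with an
error controlled in `ℓ²`. -/
theorem exists_forward_shadowing {A : ℤ → SL(2, ℝ)} {L : ℝ} (hL : 0 ≤ L)
    (hA : ∀ k X, normSq (A k • X) ≤ L * normSq X) (n : ℕ) :
    ∃ K : ℝ, 0 ≤ K ∧ ∀ W G : ℤ → Fin 2 → ℝ, (∀ k, W (k + 1) = A k • W k + G k) →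
      Summable (fun k => normSq (G k)) →
      Summable (fun k => normSq (W (k + n) - forwardProd A k n • W k)) ∧
        ∑' k, normSq (W (k + n) - forwardProd A k n • W k) ≤ K * ∑' k, normSq (G k) := by
  induction n with
  | zero =>
    refine ⟨0, le_rfl, fun W G _ _ => ?_⟩
    simp [forwardProd, normSq, summable_zero]
  | succ n ih =>
    obtain ⟨K, hK, ih⟩ := ih
    refine ⟨2 * L * K + 2, by positivity, fun W G hW hG => ?_⟩
    obtain ⟨h1, h2⟩ := ih W G hW hG
    obtain ⟨h3, h4⟩ := summable_and_tsum_le_of_le_add (p := 2 * L) (q := 2) (n : ℤ)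
      (a := fun k => normSq (W (k + (n + 1 : ℕ)) - forwardProd A k (n + 1) • W k))
      (fun k => normSq_nonneg _) h1 hG (fun k => by
        have e : W (k + (n + 1 : ℕ)) - forwardProd A k (n + 1) • W k =
            A (k + n) • (W (k + n) - forwardProd A k n • W k) + G (k + n) := by
          rw [Nat.cast_succ, ← add_assoc, hW, forwardProd, mul_smul, smul_sub]
          abel
        rw [e]
        refine (normSq_add_le _ _).trans ?_
        linarith [hA (k + n) (W (k + n) - forwardProd A k n • W k)])
    refine ⟨h3, h4.trans ?_⟩
    nlinarith [mul_le_mul_of_nonneg_left h2 (by positivity : 0 ≤ 2 * L)]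

/-- The analogue of `exists_forward_shadowing` for backward steps. -/
theorem exists_backward_shadowing {A : ℤ → SL(2, ℝ)} {L : ℝ} (hL : 0 ≤ L)
    (hA : ∀ k X, normSq ((A k)⁻¹ • X) ≤ L * normSq X) (n : ℕ) :
    ∃ K : ℝ, 0 ≤ K ∧ ∀ W G : ℤ → Fin 2 → ℝ, (∀ k, W (k + 1) = A k • W k + G k) →
      Summable (fun k => normSq (G k)) →
      Summable (fun k => normSq (W (k - n) - backwardProd A k n • W k)) ∧
        ∑' k, normSq (W (k - n) - backwardProd A k n • W k) ≤ K * ∑' k, normSq (G k) := by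
  induction n with
  | zero =>
    refine ⟨0, le_rfl, fun W G _ _ => ?_⟩
    simp [backwardProd, normSq, summable_zero]
  | succ n ih =>
    obtain ⟨K, hK, ih⟩ := ih
    refine ⟨2 * L * K + 2 * L, by positivity, fun W G hW hG => ?_⟩
    obtain ⟨h1, h2⟩ := ih W G hW hG
    obtain ⟨h3, h4⟩ := summable_and_tsum_le_of_le_add (p := 2 * L) (q := 2 * L) (-(n + 1 : ℤ))
      (a := fun k => normSq (W (k - (n + 1 : ℕ)) - backwardProd A k (n + 1) • W k))
      (fun k => normSq_nonneg _) h1 hG (fun k => by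
        have hW' := hW (k - (n + 1))
        rw [show k - ((n : ℤ) + 1) + 1 = k - n by ring] at hW'
        have e : W (k - (n + 1 : ℕ)) - backwardProd A k (n + 1) • W k =
            (A (k - (n + 1)))⁻¹ • ((W (k - n) - backwardProd A k n • W k) -
              G (k + -(n + 1 : ℤ))) := by
          rw [hW', backwardProd, mul_smul, smul_sub, smul_sub, smul_add, inv_smul_smul,
            ← sub_eq_add_neg, Nat.cast_succ]
          abel
        rw [e]
        refine (hA _ _).trans ?_
        nlinarith [mul_le_mul_of_nonneg_left (normSq_sub_le (W (k - n) - backwardProd A k n • W k)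
          (G (k + -(n + 1 : ℤ)))) hL])
    refine ⟨h3, h4.trans ?_⟩
    nlinarith [mul_le_mul_of_nonneg_left h2 (by positivity : 0 ≤ 2 * L)]

/-- Under uniform hyperbolicity an `ℓ²` sequence is controlled by its defect: the growth of
`IsUniformlyHyperbolic.exists_growth` is incompatible with translation invariance of the `ℓ²` norm,
up to the shadowing errors. -/
theorem IsUniformlyHyperbolic.exists_tsum_le {A : ℤ → SL(2, ℝ)} (h : IsUniformlyHyperbolic A)
    {L : ℝ} (hL : 0 ≤ L) (hA : ∀ k X, normSq (A k • X) ≤ L * normSq X)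
    (hA' : ∀ k X, normSq ((A k)⁻¹ • X) ≤ L * normSq X) :
    ∃ K : ℝ, 0 ≤ K ∧ ∀ W G : ℤ → Fin 2 → ℝ, (∀ k, W (k + 1) = A k • W k + G k) →
      Summable (fun k => normSq (W k)) → Summable (fun k => normSq (G k)) →
        ∑' k, normSq (W k) ≤ K * ∑' k, normSq (G k) := by
  obtain ⟨n, hn⟩ := h.exists_growth
  obtain ⟨K₁, hK₁, h₁⟩ := exists_forward_shadowing hL hA n
  obtain ⟨K₂, hK₂, h₂⟩ := exists_backward_shadowing hL hA' n
  refine ⟨(K₁ + K₂) / 2, by positivity, fun W G hW hWs hG => ?_⟩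
  obtain ⟨s₁, t₁⟩ := h₁ W G hW hG
  obtain ⟨s₂, t₂⟩ := h₂ W G hW hG
  obtain ⟨s₃, t₃⟩ := summable_and_tsum_le_of_le_add (p := 2) (q := 2) (n : ℤ)
    (a := fun k => normSq (forwardProd A k n • W k)) (fun k => normSq_nonneg _) s₁ hWs
    (fun k => by
      have h := normSq_sub_le (W (k + n)) (W (k + n) - forwardProd A k n • W k)
      rw [sub_sub_cancel] at h
      linarith)
  obtain ⟨s₄, t₄⟩ := summable_and_tsum_le_of_le_add (p := 2) (q := 2) (-(n : ℤ))
    (a := fun k => normSq (backwardProd A k n • W k)) (fun k => normSq_nonneg _) s₂ hWs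
    (fun k => by
      have h := normSq_sub_le (W (k - n)) (W (k - n) - backwardProd A k n • W k)
      rw [sub_sub_cancel] at h
      rw [← sub_eq_add_neg]
      linarith)
  have h8 := (hWs.mul_left 8).tsum_le_tsum (fun k => hn k (W k)) (s₃.add s₄)
  rw [tsum_mul_left, s₃.tsum_add s₄] at h8
  linarith

theorem transferMatrix_smul (x : ℝ) (X : Fin 2 → ℝ) :
    transferMatrix x • X = ![x * X 0 - X 1, X 0] := by
  rw [specialLinearGroup_smul_eq_mulVec]
  ext i
  fin_cases i <;> simp [transferMatrix, Matrix.mulVec, dotProduct, Fin.sum_univ_two, sub_eq_add_neg]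

theorem transferMatrix_inv_smul (x : ℝ) (X : Fin 2 → ℝ) :
    (transferMatrix x)⁻¹ • X = ![X 1, x * X 1 - X 0] := by
  rw [inv_smul_eq_iff, transferMatrix_smul]
  ext i
  fin_cases i <;> simp

theorem normSq_transferMatrix_smul_le {x B : ℝ} (hx : |x| ≤ B) (X : Fin 2 → ℝ) :
    normSq (transferMatrix x • X) ≤ (2 * B ^ 2 + 3) * normSq X := by
  have hx2 : x ^ 2 ≤ B ^ 2 := sq_le_sq.mpr (hx.trans (le_abs_self B))
  rw [transferMatrix_smul]
  simp only [normSq, Matrix.cons_val_zero, Matrix.cons_val_one]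
  nlinarith [sq_nonneg (x * X 0 + X 1), mul_le_mul_of_nonneg_right hx2 (sq_nonneg (X 0)),
    mul_nonneg (sq_nonneg B) (sq_nonneg (X 1)), sq_nonneg (X 0), sq_nonneg (X 1)]

theorem normSq_transferMatrix_inv_smul_le {x B : ℝ} (hx : |x| ≤ B) (X : Fin 2 → ℝ) :
    normSq ((transferMatrix x)⁻¹ • X) ≤ (2 * B ^ 2 + 3) * normSq X := by
  have h := normSq_transferMatrix_smul_le hx ![X 1, X 0]
  rw [transferMatrix_smul] at h
  rw [transferMatrix_inv_smul]
  simp only [normSq, Matrix.cons_val_zero, Matrix.cons_val_one] at h ⊢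
  linarith

/-! ### Uniform hyperbolicity implies invertibility -/

theorem hasSum_norm_sq (u : ell2) : HasSum (fun n => ‖u n‖ ^ 2) (‖u‖ ^ 2) := by
  have h := lp.hasSum_norm (p := 2) (by norm_num) u
  simpa using h

/-- The scalar form of `IsUniformlyHyperbolic.exists_tsum_le`, for the vectors `(a(k), a(k-1))`. -/
theorem exists_tsum_sq_le {v : ℤ → ℝ} {M : ℝ} (hv : ∀ n, |v n| ≤ M) {E : ℝ}
    (h : IsUniformlyHyperbolic (cocycle E v)) :
    ∃ K : ℝ, 0 ≤ K ∧ ∀ a f : ℤ → ℝ, (∀ n, f n = a (n + 1) + a (n - 1) + v n * a n - E * a n) →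
      Summable (fun n => a n ^ 2) → Summable (fun n => f n ^ 2) →
        ∑' n, a n ^ 2 ≤ K * ∑' n, f n ^ 2 := by
  have hB : ∀ n, |E - v n| ≤ |E| + M := fun n => (abs_sub _ _).trans (by linarith [hv n])
  obtain ⟨K, hK, hK'⟩ := h.exists_tsum_le (L := 2 * (|E| + M) ^ 2 + 3) (by positivity)
    (fun k => normSq_transferMatrix_smul_le (hB k))
    (fun k => normSq_transferMatrix_inv_smul_le (hB k))
  refine ⟨K, hK, fun a f hf ha hfs => ?_⟩
  have ha' : Summable fun n => a (n - 1) ^ 2 := ha.comp_injective (sub_left_injective (b := 1))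
  have hW : Summable fun k => normSq ![a k, a (k - 1)] := by simpa [normSq] using ha.add ha'
  have h1 := hK' (fun k => ![a k, a (k - 1)]) (fun k => ![f k, 0]) (fun k => by
      simp only [cocycle, transferMatrix_smul, add_sub_cancel_right]
      ext i
      fin_cases i
      · simp [hf]
        ring
      · simp) hW (by simpa [normSq] using hfs)
  have h2 : ∑' k, normSq ![f k, 0] = ∑' k, f k ^ 2 := tsum_congr fun k => by simp [normSq]
  rw [h2] at h1
  refine le_trans (ha.tsum_le_tsum (fun k => ?_) hW) h1
  simp [normSq, sq_nonneg]

theorem bounded_below_of_isUniformlyHyperbolic {v : ℤ → ℝ} {M : ℝ} (hv : ∀ n, |v n| ≤ M) {E : ℝ}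
    (h : IsUniformlyHyperbolic (cocycle E v)) :
    ∃ c : ℝ, 0 < c ∧ ∀ u : ell2, c * ‖u‖ ≤ ‖schrodinger v hv u - (E : ℂ) • u‖ := by
  obtain ⟨K, hK, hK'⟩ := exists_tsum_sq_le hv h
  refine ⟨(√(K + 1))⁻¹, by positivity, fun u => ?_⟩
  obtain ⟨g, hg⟩ : ∃ g, g = schrodinger v hv u - (E : ℂ) • u := ⟨_, rfl⟩
  have hgn : ∀ n, g n = u (n + 1) + u (n - 1) + v n * u n - E * u n := fun n => by rw [hg]; rfl
  rw [← hg]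
  -- The operator is real, so the estimate applies to the real and imaginary parts separately.
  have hre : ∀ w : ell2, Summable fun n => (w n).re ^ 2 := fun w =>
    Summable.of_nonneg_of_le (fun n => sq_nonneg _)
      (fun n => by rw [Complex.sq_norm, Complex.normSq_apply]; nlinarith [sq_nonneg (w n).im])
      (hasSum_norm_sq w).summable
  have him : ∀ w : ell2, Summable fun n => (w n).im ^ 2 := fun w =>
    Summable.of_nonneg_of_le (fun n => sq_nonneg _)
      (fun n => by rw [Complex.sq_norm, Complex.normSq_apply]; nlinarith [sq_nonneg (w n).re])
      (hasSum_norm_sq w).summable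
  have hnorm : ∀ w : ell2, ‖w‖ ^ 2 = ∑' n, (w n).re ^ 2 + ∑' n, (w n).im ^ 2 := fun w => by
    rw [← (hasSum_norm_sq w).tsum_eq, ← (hre w).tsum_add (him w)]
    refine tsum_congr fun n => ?_
    rw [Complex.sq_norm, Complex.normSq_apply]
    ring
  have h1 := hK' (fun n => (u n).re) (fun n => (g n).re) (fun n => by simp [hgn]) (hre u) (hre g)
  have h2 := hK' (fun n => (u n).im) (fun n => (g n).im) (fun n => by simp [hgn]) (him u) (him g)
  have h3 : ‖u‖ ^ 2 ≤ (K + 1) * ‖g‖ ^ 2 := by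
    rw [hnorm u]
    nlinarith [hnorm g, sq_nonneg ‖g‖]
  rw [inv_mul_le_iff₀ (by positivity)]
  refine le_of_sq_le_sq ?_ (by positivity)
  rw [mul_pow, Real.sq_sqrt (by positivity)]
  exact h3

/-! ### Sequences whose block sums are dominated by their boundary values -/

section BoundarySums

open Filter Topology

/-- If every block sum of `g ≥ 0` is dominated by the boundary values and `g → 0`, then the tails
`R m = ∑_{i ≥ m} g i` satisfy `R m ≤ K g m = K (R m - R (m + 1))`, so they decay geometrically. -/
theorem le_geometric_of_block_sum_le {g : ℕ → ℝ} {K : ℝ} (hK : 1 < K) (hg0 : ∀ n, 0 ≤ g n)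
    (hg : ∀ m n, ∑ i ∈ Finset.range (n + 1), g (m + i) ≤ K * (g m + g (m + n)))
    (hlim : Tendsto g atTop (𝓝 0)) (n : ℕ) : g n ≤ K * (1 - K⁻¹) ^ n * g 0 := by
  obtain ⟨B, hB⟩ := hlim.bddAbove_range
  have hB' : ∀ n, g n ≤ B := fun n => hB ⟨n, rfl⟩
  have hsum : Summable g := by
    refine summable_of_sum_range_le (c := K * (B + B)) hg0 fun n => ?_
    have h1 := hg 0 n
    simp only [zero_add] at h1
    rw [Finset.sum_range_succ] at h1
    nlinarith [hg0 n, hB' n, hB' 0]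
  have hsum' : ∀ m, Summable fun i => g (m + i) := fun m =>
    hsum.comp_injective (add_right_injective m)
  obtain ⟨R, hR⟩ : ∃ R : ℕ → ℝ, ∀ m, R m = ∑' i, g (m + i) := ⟨_, fun _ => rfl⟩
  have hRK : ∀ m, R m ≤ K * g m := by
    intro m
    have t1 := (hsum' m).hasSum.tendsto_sum_nat.comp (tendsto_add_atTop_nat 1)
    have t2 : Tendsto (fun n => K * (g m + g (m + n))) atTop (𝓝 (K * (g m + 0))) :=
      ((hlim.comp (tendsto_add_atTop_nat m)).congr
        (fun n => by simp [add_comm])).const_add (g m) |>.const_mul K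
    rw [add_zero] at t2
    rw [hR]
    exact le_of_tendsto_of_tendsto' t1 t2 fun n => hg m n
  have hRsucc : ∀ m, R m = g m + R (m + 1) := by
    intro m
    rw [hR, hR, (hsum' m).tsum_eq_zero_add, add_zero]
    congr 1
    exact tsum_congr fun i => by congr 1; ring
  have hR0 : ∀ m, 0 ≤ R m := fun m => by rw [hR]; exact tsum_nonneg fun i => hg0 _
  have hstep : ∀ m, R (m + 1) ≤ (1 - K⁻¹) * R m := by
    intro m
    have h1 : K⁻¹ * R m ≤ g m := by
      rw [inv_mul_le_iff₀ (by linarith)]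
      exact hRK m
    linarith [hRsucc m]
  have hθ : 0 ≤ 1 - K⁻¹ := by
    have := inv_le_one_of_one_le₀ hK.le
    linarith
  have hgeom : ∀ m, R m ≤ (1 - K⁻¹) ^ m * R 0 := by
    intro m
    induction m with
    | zero => simp
    | succ m ih =>
      refine (hstep m).trans ?_
      rw [pow_succ']
      nlinarith [mul_le_mul_of_nonneg_left ih hθ]
  have h1 : g n ≤ R n := by linarith [hRsucc n, hR0 (n + 1)]
  have h2 := mul_le_mul_of_nonneg_left (hRK 0) (pow_nonneg hθ n)
  linarith [hgeom n]

theorem decay_of_block_sum_le {S : ℤ → ℝ} {K B : ℝ} (hK : 1 < K) (hS0 : ∀ n, 0 ≤ S n)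
    (hS : ∀ (a : ℤ) (n : ℕ), ∑ i ∈ Finset.range (n + 1), S (a + i) ≤ K * (S a + S (a + n)))
    (hB : ∀ n : ℕ, ∑ i ∈ Finset.range n, S i ≤ B) (a : ℤ) (n : ℕ) :
    S (a + n) ≤ K * (1 - K⁻¹) ^ n * S a := by
  have hsum : Summable fun i : ℕ => S i := summable_of_sum_range_le (fun i => hS0 i) hB
  have hlim : Tendsto S atTop (𝓝 0) := by
    rw [← Nat.map_cast_int_atTop, tendsto_map'_iff]
    exact hsum.tendsto_atTop_zero
  have h := le_geometric_of_block_sum_le (g := fun i : ℕ => S (a + i)) hK (fun i => hS0 _)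
    (fun m n => by simpa [add_assoc] using hS (a + m) n)
    (hlim.comp (tendsto_atTop_add_const_left _ a tendsto_natCast_atTop_atTop)) n
  simpa using h

theorem block_sum_le_neg {S : ℤ → ℝ} {K : ℝ}
    (hS : ∀ (a : ℤ) (n : ℕ), ∑ i ∈ Finset.range (n + 1), S (a + i) ≤ K * (S a + S (a + n)))
    (a : ℤ) (n : ℕ) :
    ∑ i ∈ Finset.range (n + 1), S (-(a + i)) ≤ K * (S (-a) + S (-(a + n))) := by
  have h := hS (-(a + n)) n
  rw [← Finset.sum_range_reflect] at h
  rw [show -(a + n) + (n : ℤ) = -a by ring, add_comm (S _)] at h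
  refine le_trans (le_of_eq (Finset.sum_congr rfl fun i hi => ?_)) h
  have hi' : i ≤ n := Nat.lt_succ_iff.mp (Finset.mem_range.mp hi)
  congr 1
  omega

end BoundarySums

/-! ### Truncated solutions -/

theorem sum_Icc_int (F : ℤ → ℝ) (a : ℤ) (n : ℕ) :
    ∑ k ∈ Finset.Icc a (a + n), F k = ∑ i ∈ Finset.range (n + 1), F (a + i) := by
  refine Finset.sum_nbij' (fun k => (k - a).toNat) (fun i => a + i) ?_ ?_ ?_ ?_ ?_
  · intro k hk
    simp only [Finset.mem_Icc, Finset.mem_range] at hk ⊢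
    omega
  · intro i hi
    simp only [Finset.mem_Icc, Finset.mem_range] at hi ⊢
    omega
  · intro k hk
    simp only [Finset.mem_Icc] at hk
    omega
  · intro i _
    simp
  · intro k hk
    simp only [Finset.mem_Icc] at hk
    congr 1
    omega

/-- Truncating a solution `w` of `H_v w = E w` to `[a, b]` produces a vector `u` for which
`(H_v - E) u` is supported at the four points `a - 1, a, b, b + 1`. -/
theorem sum_sq_le_of_bounded_below {v : ℤ → ℝ} {M : ℝ} (hv : ∀ n, |v n| ≤ M) {E c : ℝ} (hc : 0 < c)
    (h : ∀ u : ell2, c * ‖u‖ ≤ ‖schrodinger v hv u - (E : ℂ) • u‖) {w : ℤ → ℝ}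
    (hw : ∀ n, w (n + 1) = (E - v n) * w n - w (n - 1)) {a b : ℤ} (hab : a ≤ b) :
    c ^ 2 * ∑ k ∈ Finset.Icc a b, w k ^ 2 ≤
      4 * (w a ^ 2 + w (a - 1) ^ 2 + w (b + 1) ^ 2 + w b ^ 2) := by
  obtain ⟨u, hu⟩ : ∃ u : ell2,
      u = ∑ k ∈ Finset.Icc a b, lp.single (E := fun _ : ℤ => ℂ) 2 k ((w k : ℝ) : ℂ) := ⟨_, rfl⟩
  have hun : ∀ n, u n = if a ≤ n ∧ n ≤ b then (w n : ℂ) else 0 := by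
    intro n
    rw [hu, lp.coeFn_sum, Finset.sum_apply]
    simp only [lp.coeFn_single]
    rw [Finset.sum_pi_single]
    simp only [Finset.mem_Icc]
  have hnorm : ‖u‖ ^ 2 = ∑ k ∈ Finset.Icc a b, w k ^ 2 := by
    have h1 := lp.norm_sum_single (E := fun _ : ℤ => ℂ) (p := 2) (by norm_num)
      (fun k => (w k : ℂ)) (Finset.Icc a b)
    rw [← hu] at h1
    simpa using h1
  have single_apply : ∀ (m : ℤ) (z : ℂ) (n : ℤ),
      lp.single (E := fun _ : ℤ => ℂ) 2 m z n = if n = m then z else 0 := by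
    intro m z n
    rw [lp.coeFn_single, Pi.single_apply]
  have hf : schrodinger v hv u - (E : ℂ) • u =
      lp.single (E := fun _ : ℤ => ℂ) 2 (a - 1) (w a : ℂ) - lp.single 2 a (w (a - 1) : ℂ)
        - lp.single 2 b (w (b + 1) : ℂ) + lp.single 2 (b + 1) (w b : ℂ) := by
    ext n
    have hwn : (w (n + 1) : ℂ) = (E - v n) * w n - w (n - 1) := by exact_mod_cast hw n
    have e1 : (if n = a - 1 then (w a : ℂ) else 0) = if n = a - 1 then (w (n + 1) : ℂ) else 0 := by
      split_ifs with hn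
      · rw [hn, sub_add_cancel]
      · rfl
    have e2 : (if n = a then (w (a - 1) : ℂ) else 0) = if n = a then (w (n - 1) : ℂ) else 0 := by
      split_ifs with hn
      · rw [hn]
      · rfl
    have e3 : (if n = b then (w (b + 1) : ℂ) else 0) = if n = b then (w (n + 1) : ℂ) else 0 := by
      split_ifs with hn
      · rw [hn]
      · rfl
    have e4 : (if n = b + 1 then (w b : ℂ) else 0) = if n = b + 1 then (w (n - 1) : ℂ) else 0 := by
      split_ifs with hn
      · rw [hn, add_sub_cancel_right]
      · rfl
    change u (n + 1) + u (n - 1) + (v n : ℂ) * u n - E * u n =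
      lp.single (E := fun _ : ℤ => ℂ) 2 (a - 1) (w a : ℂ) n
        - lp.single (E := fun _ : ℤ => ℂ) 2 a (w (a - 1) : ℂ) n
        - lp.single (E := fun _ : ℤ => ℂ) 2 b (w (b + 1) : ℂ) n
        + lp.single (E := fun _ : ℤ => ℂ) 2 (b + 1) (w b : ℂ) n
    rw [single_apply, single_apply, single_apply, single_apply, e1, e2, e3, e4, hun, hun, hun]
    split_ifs <;> first
      | (exfalso; omega)
      | linear_combination hwn
      | ring
  have hle : ‖schrodinger v hv u - (E : ℂ) • u‖ ≤ |w a| + |w (a - 1)| + |w (b + 1)| + |w b| := by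
    rw [hf]
    refine (norm_add_le _ _).trans (add_le_add ((norm_sub_le _ _).trans
      (add_le_add ((norm_sub_le _ _).trans (add_le_add ?_ ?_)) ?_)) ?_) <;>
    · rw [lp.norm_single (by norm_num), Complex.norm_real, Real.norm_eq_abs]
  have h1 := pow_le_pow_left₀ (by positivity) ((h u).trans hle) 2
  rw [mul_pow, hnorm] at h1
  refine h1.trans ?_
  rw [← sq_abs (w a), ← sq_abs (w (a - 1)), ← sq_abs (w (b + 1)), ← sq_abs (w b)]
  nlinarith [sq_nonneg (|w a| - |w (a - 1)|), sq_nonneg (|w a| - |w (b + 1)|),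
    sq_nonneg (|w a| - |w b|), sq_nonneg (|w (a - 1)| - |w (b + 1)|),
    sq_nonneg (|w (a - 1)| - |w b|), sq_nonneg (|w (b + 1)| - |w b|)]

/-- Along an orbit of the Schrödinger cocycle, block sums of the squared norm are dominated by the
boundary values, provided `H_v - E` is bounded below. -/
theorem exists_orbit_block_sum_le {v : ℤ → ℝ} {M : ℝ} (hv : ∀ n, |v n| ≤ M) {E c : ℝ} (hc : 0 < c)
    (h : ∀ u : ell2, c * ‖u‖ ≤ ‖schrodinger v hv u - (E : ℂ) • u‖) :
    ∃ K : ℝ, 1 < K ∧ ∀ W : ℤ → Fin 2 → ℝ, (∀ k, cocycle E v k • W k = W (k + 1)) →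
      ∀ (a : ℤ) (n : ℕ), ∑ i ∈ Finset.range (n + 1), normSq (W (a + i)) ≤
        K * (normSq (W a) + normSq (W (a + n))) := by
  refine ⟨8 / c ^ 2 + 2, by linarith [show 0 < 8 / c ^ 2 by positivity], fun W hW a n => ?_⟩
  have hK : 0 < 8 / c ^ 2 := by positivity
  have hW0 : ∀ k, W (k + 1) 0 = (E - v k) * W k 0 - W k 1 := fun k => by
    rw [← hW, cocycle, transferMatrix_smul]
    rfl
  have hW1 : ∀ k, W k 1 = W (k - 1) 0 := fun k => by
    have h1 := congrFun (hW (k - 1)) 1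
    rw [cocycle, transferMatrix_smul, sub_add_cancel] at h1
    exact h1.symm
  have hSq : ∀ k, normSq (W k) = W k 0 ^ 2 + W (k - 1) 0 ^ 2 := fun k => by rw [normSq, hW1]
  cases n with
  | zero =>
    simp only [zero_add, Finset.sum_range_one, Nat.cast_zero, add_zero]
    nlinarith [normSq_nonneg (W a)]
  | succ m =>
    have hcut := sum_sq_le_of_bounded_below hv hc h (w := fun k => W k 0)
      (fun k => by rw [hW0, hW1]) (show a ≤ a + m by omega)
    rw [sum_Icc_int] at hcut
    have hcut' : ∑ i ∈ Finset.range (m + 1), W (a + i) 0 ^ 2 ≤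
        4 / c ^ 2 * (normSq (W a) + normSq (W (a + (m + 1 : ℕ)))) := by
      have e : a + ((m + 1 : ℕ) : ℤ) = a + m + 1 := by push_cast; ring
      rw [e, hSq a, hSq (a + m + 1), add_sub_cancel_right, div_mul_eq_mul_div,
        le_div_iff₀ (by positivity)]
      linarith
    rw [Finset.sum_range_succ, Finset.sum_range_succ', Nat.cast_zero, add_zero]
    have hmid : ∑ i ∈ Finset.range m, normSq (W (a + (i + 1 : ℕ))) ≤
        2 * ∑ i ∈ Finset.range (m + 1), W (a + i) 0 ^ 2 := by
      have e : ∀ i : ℕ, normSq (W (a + (i + 1 : ℕ))) =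
          W (a + (i + 1 : ℕ)) 0 ^ 2 + W (a + i) 0 ^ 2 := fun i => by
        rw [hSq]
        congr 4
        push_cast
        ring
      rw [Finset.sum_congr rfl fun i _ => e i, Finset.sum_add_distrib, two_mul]
      refine add_le_add ?_ ?_
      · rw [Finset.sum_range_succ' _ m]
        exact le_add_of_nonneg_right (sq_nonneg _)
      · rw [Finset.sum_range_succ _ m]
        exact le_add_of_nonneg_right (sq_nonneg _)
    have h8 : 8 / c ^ 2 = 2 * (4 / c ^ 2) := by ring
    rw [h8]
    nlinarith [normSq_nonneg (W a), normSq_nonneg (W (a + (m + 1 : ℕ)))]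

/-! ### Vectors with bounded orbit sums -/

/-- A matrix of determinant one does not expand all unit vectors. -/
theorem exists_normSq_smul_le (g : SL(2, ℝ)) : ∃ X, normSq X = 1 ∧ normSq (g • X) ≤ 1 := by
  suffices h : ∃ Y, Y ≠ 0 ∧ normSq (g • Y) ≤ normSq Y by
    obtain ⟨Y, hY, hgY⟩ := h
    have hpos := normSq_pos hY
    have hs : (√(normSq Y))⁻¹ ^ 2 = (normSq Y)⁻¹ := by rw [inv_pow, Real.sq_sqrt hpos.le]
    refine ⟨(√(normSq Y))⁻¹ • Y, ?_, ?_⟩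
    · rw [normSq_smul, hs, inv_mul_cancel₀ hpos.ne']
    · rw [smul_comm, normSq_smul, hs, inv_mul_le_iff₀ hpos, mul_one]
      exact hgY
  obtain ⟨a, ha⟩ : ∃ a, a = g.1 0 0 := ⟨_, rfl⟩
  obtain ⟨b, hb⟩ : ∃ b, b = g.1 0 1 := ⟨_, rfl⟩
  obtain ⟨c, hc⟩ : ∃ c, c = g.1 1 0 := ⟨_, rfl⟩
  obtain ⟨d, hd⟩ : ∃ d, d = g.1 1 1 := ⟨_, rfl⟩
  have hdet : a * d - b * c = 1 := by
    have h := g.2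
    rwa [Matrix.det_fin_two, ← ha, ← hb, ← hc, ← hd] at h
  have hg : ∀ Y, normSq (g • Y) = (a * Y 0 + b * Y 1) ^ 2 + (c * Y 0 + d * Y 1) ^ 2 := fun Y => by
    rw [specialLinearGroup_smul_eq_mulVec]
    simp [normSq, Matrix.mulVec, dotProduct, Fin.sum_univ_two, ha, hb, hc, hd]
  -- `p, q, r` are the entries of `gᵀ g`; the form `gᵀ g - 1` has nonpositive determinant
  -- `2 - p - r`, so it is nonpositive at `(1, 0)` or at `(-q, p - 1)`.
  obtain ⟨p, hp⟩ : ∃ p, p = a ^ 2 + c ^ 2 := ⟨_, rfl⟩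
  obtain ⟨q, hq⟩ : ∃ q, q = a * b + c * d := ⟨_, rfl⟩
  obtain ⟨r, hr⟩ : ∃ r, r = b ^ 2 + d ^ 2 := ⟨_, rfl⟩
  have hg' : ∀ Y, normSq (g • Y) = p * Y 0 ^ 2 + 2 * q * Y 0 * Y 1 + r * Y 1 ^ 2 := fun Y => by
    rw [hg, hp, hq, hr]
    ring
  have hpqr : p * r - q ^ 2 = 1 := by
    rw [hp, hq, hr]
    linear_combination (a * d - b * c + 1) * hdet
  have htr : 2 ≤ p + r := by
    rw [hp, hr]
    nlinarith [sq_nonneg (a - d), sq_nonneg (b + c)]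
  by_cases h1 : p ≤ 1
  · refine ⟨![1, 0], fun h => by simpa using congrFun h 0, ?_⟩
    rw [hg']
    simpa [normSq] using h1
  · rw [not_le] at h1
    refine ⟨![-q, p - 1], fun h => by
      have := congrFun h 1
      simp at this
      linarith, ?_⟩
    rw [hg']
    simp only [normSq, Matrix.cons_val_zero, Matrix.cons_val_one]
    have e : p * (-q) ^ 2 + 2 * q * (-q) * (p - 1) + r * (p - 1) ^ 2 - ((-q) ^ 2 + (p - 1) ^ 2) =
        (p - 1) * (2 - (p + r)) := by
      linear_combination (p - 1) * hpqr
    nlinarith [mul_nonneg (sub_nonneg.mpr h1.le) (sub_nonneg.mpr htr)]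

theorem continuous_normSq_smul (g : SL(2, ℝ)) : Continuous fun X : Fin 2 → ℝ => normSq (g • X) := by
  simp only [specialLinearGroup_smul_eq_mulVec, normSq, Matrix.mulVec, dotProduct,
    Fin.sum_univ_two]
  fun_prop

theorem isCompact_normSq_eq_one : IsCompact {X : Fin 2 → ℝ | normSq X = 1} := by
  have hcont : Continuous normSq := by simpa using continuous_normSq_smul 1
  refine (isCompact_Icc (a := (fun _ => -1 : Fin 2 → ℝ)) (b := fun _ => 1)).of_isClosed_subset
    (isClosed_eq hcont continuous_const) fun X hX => ?_
  have hX' : X 0 ^ 2 + X 1 ^ 2 = 1 := hX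
  have h0 := abs_le.mp (abs_le_one_iff_mul_self_le_one.mpr
    (by nlinarith [sq_nonneg (X 1)] : X 0 * X 0 ≤ 1))
  have h1 := abs_le.mp (abs_le_one_iff_mul_self_le_one.mpr
    (by nlinarith [sq_nonneg (X 0)] : X 1 * X 1 ≤ 1))
  refine ⟨fun i => ?_, fun i => ?_⟩
  · fin_cases i
    exacts [h0.1, h1.1]
  · fin_cases i
    exacts [h0.2, h1.2]

/-- A unit vector not expanded by `Φ n` has orbit sum at most `2 K` up to time `n`; by compactness
some unit vector has this property for all times. -/
theorem exists_bounded_orbit_sum {Φ : ℕ → SL(2, ℝ)} {K : ℝ} (hK : 0 ≤ K) (hΦ : Φ 0 = 1)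
    (h : ∀ X n, ∑ i ∈ Finset.range (n + 1), normSq (Φ i • X) ≤
      K * (normSq (Φ 0 • X) + normSq (Φ n • X))) :
    ∃ X, normSq X = 1 ∧ ∀ n, ∑ i ∈ Finset.range n, normSq (Φ i • X) ≤ 2 * K := by
  have hcont : ∀ n, Continuous fun X => ∑ i ∈ Finset.range n, normSq (Φ i • X) := fun n =>
    continuous_finsetSum _ fun i _ => continuous_normSq_smul (Φ i)
  have hclosed : ∀ n, IsClosed ({X | normSq X = 1} ∩
      {X | ∑ i ∈ Finset.range n, normSq (Φ i • X) ≤ 2 * K}) := fun n =>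
    isCompact_normSq_eq_one.isClosed.inter (isClosed_le (hcont n) continuous_const)
  obtain ⟨X, hX⟩ := IsCompact.nonempty_iInter_of_sequence_nonempty_isCompact_isClosed
    (fun n => {X | normSq X = 1} ∩ {X | ∑ i ∈ Finset.range n, normSq (Φ i • X) ≤ 2 * K})
    (fun n X hX => ⟨hX.1, by
      have h2 : ∑ i ∈ Finset.range (n + 1), normSq (Φ i • X) ≤ 2 * K := hX.2
      rw [Finset.sum_range_succ] at h2
      have := normSq_nonneg (Φ n • X)
      change ∑ i ∈ Finset.range n, normSq (Φ i • X) ≤ 2 * K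
      linarith⟩)
    (fun n => by
      obtain ⟨X, hX, hgX⟩ := exists_normSq_smul_le (Φ n)
      refine ⟨X, hX, ?_⟩
      have h2 := h X n
      rw [hΦ, one_smul, hX, Finset.sum_range_succ] at h2
      have := normSq_nonneg (Φ n • X)
      change ∑ i ∈ Finset.range n, normSq (Φ i • X) ≤ 2 * K
      nlinarith)
    (isCompact_normSq_eq_one.inter_right (isClosed_le (hcont 0) continuous_const)) hclosed
  rw [Set.mem_iInter] at hX
  exact ⟨X, (hX 0).1, fun n => (hX n).2⟩

/-! ### Invertibility implies uniform hyperbolicity -/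

theorem orbit_ne_zero {A : ℤ → SL(2, ℝ)} {W : ℤ → Fin 2 → ℝ} (hW : ∀ k, A k • W k = W (k + 1))
    (h0 : W 0 ≠ 0) (k : ℤ) : W k ≠ 0 := by
  obtain ⟨n, rfl | rfl⟩ := k.eq_nat_or_neg
  · rw [← zero_add (n : ℤ), ← forwardProd_smul hW]
    exact (smul_ne_zero_iff_ne _).mpr h0
  · rw [← zero_sub, ← backwardProd_smul hW]
    exact (smul_ne_zero_iff_ne _).mpr h0

theorem euclNorm_smul_le_of_normSq_le {w x : Fin 2 → ℝ} (hw : w ≠ 0) {g : SL(2, ℝ)} {B : ℝ}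
    (hB : 0 ≤ B) (hg : normSq (g • w) ≤ B ^ 2 * normSq w)
    (hx : x ∈ (Projectivization.mk ℝ w hw).submodule) (hx1 : euclNorm x = 1) :
    euclNorm (g.1 *ᵥ x) ≤ B := by
  rw [Projectivization.submodule_mk, Submodule.mem_span_singleton] at hx
  obtain ⟨c, rfl⟩ := hx
  have h1 : c ^ 2 * normSq w = 1 := by rw [← normSq_smul, ← euclNorm_sq, hx1, one_pow]
  refine le_of_sq_le_sq ?_ hB
  rw [euclNorm_sq, Matrix.mulVec_smul, normSq_smul, ← specialLinearGroup_smul_eq_mulVec]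
  nlinarith [mul_le_mul_of_nonneg_left hg (sq_nonneg c)]

/-- Two orbits decaying geometrically in opposite time directions span invariant directions that
make the cocycle uniformly hyperbolic. -/
theorem isUniformlyHyperbolic_of_decay {A : ℤ → SL(2, ℝ)} {K θ : ℝ} (hK : 0 < K) (hθ0 : 0 < θ)
    (hθ1 : θ < 1) {U W : ℤ → Fin 2 → ℝ} (hU : ∀ k, A k • U k = U (k + 1))
    (hW : ∀ k, A k • W k = W (k + 1)) (hU0 : U 0 ≠ 0) (hW0 : W 0 ≠ 0)
    (hUd : ∀ (k : ℤ) (n : ℕ), normSq (U (k - n)) ≤ K * θ ^ n * normSq (U k))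
    (hWd : ∀ (k : ℤ) (n : ℕ), normSq (W (k + n)) ≤ K * θ ^ n * normSq (W k)) :
    IsUniformlyHyperbolic A := by
  have hUne := orbit_ne_zero hU hU0
  have hWne := orbit_ne_zero hW hW0
  refine ⟨fun k => Projectivization.mk ℝ (U k) (hUne k),
    fun k => Projectivization.mk ℝ (W k) (hWne k), fun k => ⟨?_, ?_⟩, √K, (√θ)⁻¹,
    Real.sqrt_pos.mpr hK, ?_, fun n _ k => ?_⟩
  · simp only [Projectivization.smul_mk, hU]
  · simp only [Projectivization.smul_mk, hW]
  · refine (one_lt_inv₀ (Real.sqrt_pos.mpr hθ0)).mpr ?_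
    rw [Real.sqrt_lt' one_pos, one_pow]
    exact hθ1
  · have e : √K * (√θ)⁻¹ ^ (-(n : ℤ)) = √K * √θ ^ n := by
      rw [inv_zpow', neg_neg, zpow_natCast]
    have e2 : (√K * √θ ^ n) ^ 2 = K * θ ^ n := by
      rw [mul_pow, Real.sq_sqrt hK.le, ← pow_mul, mul_comm n, pow_mul, Real.sq_sqrt hθ0.le]
    rw [e]
    refine ⟨fun x hx hx1 => euclNorm_smul_le_of_normSq_le (hUne k) (by positivity) ?_ hx hx1,
      fun x hx hx1 => euclNorm_smul_le_of_normSq_le (hWne k) (by positivity) ?_ hx hx1⟩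
    · rw [iter_neg_natCast, backwardProd_smul hU, e2]
      exact hUd k n
    · rw [iter_natCast, forwardProd_smul hW, e2]
      exact hWd k n

theorem isUniformlyHyperbolic_of_bounded_below {v : ℤ → ℝ} {M : ℝ} (hv : ∀ n, |v n| ≤ M) {E c : ℝ}
    (hc : 0 < c) (h : ∀ u : ell2, c * ‖u‖ ≤ ‖schrodinger v hv u - (E : ℂ) • u‖) :
    IsUniformlyHyperbolic (cocycle E v) := by
  obtain ⟨K, hK, hblock⟩ := exists_orbit_block_sum_le hv hc h
  have ne_zero : ∀ X : Fin 2 → ℝ, normSq X = 1 → X ≠ 0 := by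
    rintro X hX rfl
    simp [normSq] at hX
  obtain ⟨X, hX, hXsum⟩ := exists_bounded_orbit_sum (Φ := forwardProd (cocycle E v) 0)
    (zero_le_one.trans hK.le) rfl fun X n => by
      obtain ⟨W, rfl, hW⟩ := exists_orbit (cocycle E v) 0 X
      simp only [forwardProd_smul hW]
      simpa using hblock W hW 0 n
  obtain ⟨Y, hY, hYsum⟩ := exists_bounded_orbit_sum (Φ := backwardProd (cocycle E v) 0)
    (zero_le_one.trans hK.le) rfl fun Y n => by
      obtain ⟨W, rfl, hW⟩ := exists_orbit (cocycle E v) 0 Y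
      simp only [backwardProd_smul hW]
      simpa using block_sum_le_neg (S := fun k => normSq (W k)) (hblock W hW) 0 n
  obtain ⟨W, rfl, hW⟩ := exists_orbit (cocycle E v) 0 X
  obtain ⟨U, rfl, hU⟩ := exists_orbit (cocycle E v) 0 Y
  simp only [forwardProd_smul hW, zero_add] at hXsum
  simp only [backwardProd_smul hU, zero_sub] at hYsum
  refine isUniformlyHyperbolic_of_decay (K := K) (θ := 1 - K⁻¹) (by linarith)
    (sub_pos.mpr (inv_lt_one_of_one_lt₀ hK)) (sub_lt_self 1 (inv_pos.mpr (by linarith)))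
    hU hW (ne_zero _ hY) (ne_zero _ hX) (fun k n => ?_) (fun k n => ?_)
  · have h1 := decay_of_block_sum_le (S := fun k => normSq (U (-k))) hK
      (fun k => normSq_nonneg _) (block_sum_le_neg (S := fun k => normSq (U k)) (hblock U hU))
      hYsum (-k) n
    rw [show -(-k + (n : ℤ)) = k - n by ring, neg_neg] at h1
    exact h1
  · exact decay_of_block_sum_le (S := fun k => normSq (W k)) hK (fun k => normSq_nonneg _)
      (hblock W hW) hXsum k n

end DiscreteSchrodinger

theorem theoremt (v : ℤ → ℝ) (M : ℝ) (hv : ∀ n, |v n| ≤ M) :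
    spectrum ℂ (DiscreteSchrodinger.schrodinger v hv) =
      ((↑) : ℝ → ℂ) ''
        {E : ℝ | ¬ DiscreteSchrodinger.IsUniformlyHyperbolic (DiscreteSchrodinger.cocycle E v)} := by
  have key : ∀ E : ℝ, (E : ℂ) ∉ spectrum ℂ (DiscreteSchrodinger.schrodinger v hv) ↔
      DiscreteSchrodinger.IsUniformlyHyperbolic (DiscreteSchrodinger.cocycle E v) := by
    intro E
    rw [DiscreteSchrodinger.notMem_spectrum_iff_bounded_below]
    exact ⟨fun ⟨_, hc, h⟩ => DiscreteSchrodinger.isUniformlyHyperbolic_of_bounded_below hv hc h,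
      DiscreteSchrodinger.bounded_below_of_isUniformlyHyperbolic hv⟩
  ext z
  constructor
  · intro hz
    have hre := DiscreteSchrodinger.spectrum_schrodinger_eq_re hv hz
    refine ⟨z.re, fun hUH => (key z.re).mpr hUH ?_, hre.symm⟩
    rwa [← hre]
  · rintro ⟨E, hE, rfl⟩
    by_contra hz
    exact hE ((key E).mp hz)
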